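/- Let $0<\lambda<1$, let $b_1<b_2<\dots<b_N$ be real numbers ($N\ge 1$), let $p_1,\dots,p_N>0$ with $\sum_{i=1}^N p_i=1$, and put $\tau_i(x)=\lambda x+b_i$ for $x\in\mathbb R$. Let $X\subset\mathbb R$ be the attractor, i.e. the unique nonempty compact set with $X=\bigcup_{i=1}^N\tau_i(X)$, and let $\mu$ be the self-similar measure, i.e. the unique Borel probability measure on $\mathbb R$ with $\mu(E)=\sum_{i=1}^N p_i\,\mu(\tau_i^{-1}(E))$ for all Borel sets $E$. Let $\alpha$ be a real number such that the $\alpha$-dimensional Hausdorff measure $\mathcal H^\alpha$ satisfies $0<\mathcal H^\alpha(X)<\infty$ and $\mu\ll\mathcal H^\alpha|_X$. A Borel measure $\nu$ on $\mathbb R$ is called a frame measure for $\mu$ if there are constants $A,B>0$ such that for all $f\in L^2(\mu)$ $$A\|f\|_{L^2(\mu)}^2\le\int_{\mathbb R}\Big|\int_{\mathbb R} f(x)e^{-2\pi i t x}\,d\mu(x)\Big|^2d\nu(t)\le B\|f\|_{L^2(\mu)}^2 .$$ Suppose that $\mu$ admits a frame measure. Then: (i) $p_1=p_N$. (ii) If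 $\alpha=1$ (so that $\mu$ is absolutely continuous with respect to Lebesgue measure on $X$), then $p_j\le\lambda$ for all $j=1,\dots,N$, and $p_1=p_N=\lambda$. -/

import Mathlib

open MeasureTheory

/-- The maps `τ_i(x) = lam * x + b i` of a one-dimensional self-similar iterated function system. -/
def ifsMap {N : ℕ} (lam : ℝ) (b : Fin N → ℝ) (i : Fin N) (x : ℝ) : ℝ :=
  lam * x + b i

/-- `X` is the attractor of the system: the (unique) nonempty compact set with
`X = ⋃ i, τ_i(X)`. -/
structure IsAttractor {N : ℕ} (lam : ℝ) (b : Fin N → ℝ) (X : Set ℝ) : Prop where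
  isCompact : IsCompact X
  nonempty : X.Nonempty
  invariant : X = ⋃ i, ifsMap lam b i '' X

/-- `μ` is the self-similar measure with weights `p`: the (unique) Borel probability measure with
`μ(E) = ∑ i, p i * μ(τ_i⁻¹(E))` for all Borel sets `E`. -/
structure IsSelfSimilarMeasure {N : ℕ} (lam : ℝ) (b p : Fin N → ℝ) (μ : Measure ℝ) : Prop where
  isProbabilityMeasure : IsProbabilityMeasure μ
  invariant : ∀ E : Set ℝ, MeasurableSet E →
    μ E = ∑ i, ENNReal.ofReal (p i) * μ (ifsMap lam b i ⁻¹' E)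

/-- The Fourier transform `t ↦ ∫ f(x) exp(-2πitx) dμ(x)` of `f dμ`. -/
noncomputable def fourierMeasure (μ : Measure ℝ) (f : ℝ → ℂ) (t : ℝ) : ℂ :=
  ∫ x, f x * Complex.exp (-(2 * Real.pi * t * x : ℝ) * Complex.I) ∂μ

/-- The Borel measure `ν` is a frame measure for `μ`: there are constants `A, B > 0` with
`A ‖f‖² ≤ ‖(f dμ)^‖² ≤ B ‖f‖²` for all `f ∈ L²(μ)`, where the outer norms are those of `L²(μ)`
and the middle one is that of `L²(ν)`. -/
def IsFrameMeasure (μ ν : Measure ℝ) : Prop :=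
  ∃ A B : ℝ, 0 < A ∧ 0 < B ∧ ∀ f : ℝ → ℂ, MemLp f 2 μ →
    ENNReal.ofReal A * eLpNorm f 2 μ ^ 2 ≤ eLpNorm (fourierMeasure μ f) 2 ν ^ 2 ∧
    eLpNorm (fourierMeasure μ f) 2 ν ^ 2 ≤ ENNReal.ofReal B * eLpNorm f 2 μ ^ 2

open scoped ENNReal

/-! A frame measure sees only the modulus of a Fourier transform, and translation does not change
it. So if `σ` and a translate `σ'` both have bounded densities with respect to `μ`, the `L²(μ)`
norms of these densities agree up to the factor `B / A`. This is `FrameBounds.translate_le`, which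
bounds the first norm above through `σ ≤ K • μ` and the second below by Cauchy–Schwarz on a set `U`.

Weights: the images of `μ` under the `k`-th iterates of two of the maps are translates of each
other. The `j`-th is at most `p j ^ (-k)` times `μ`; for an extreme map `i` the image lives on a
ball of measure at most `C * p i ^ k`. Hence `p j ^ k` is at most a constant times `p i ^ k` for all
`k`, so `p j ≤ p i`; using both ends gives (i).

Absolutely continuous case: translating pieces of Lebesgue measure shows that the density is
bounded, and bounded below where it is nonzero. Near an extreme fixed point the measure scales like
`p i ^ k` and the length like `lam ^ k`, which forces `p i = lam`. -/

theorem le_of_forall_mul_pow_le {x y : ℝ} (hx : 0 < x) (hy : 0 < y) {a C : ℝ≥0∞} (ha : a ≠ 0)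
    (hC : C ≠ ∞) (h : ∀ k : ℕ, a * ENNReal.ofReal x ^ k ≤ C * ENNReal.ofReal y ^ k) : x ≤ y := by
  by_contra! hlt
  have hat : a ≠ ∞ := by
    rintro rfl
    simpa [hC] using h 0
  have hr : 1 < x / y := (one_lt_div hy).2 hlt
  have ha' : 0 < a.toReal := ENNReal.toReal_pos ha hat
  obtain ⟨k, hk⟩ := pow_unbounded_of_one_lt (C.toReal / a.toReal) hr
  have h2 := ENNReal.toReal_mono (by finiteness) (h k)
  simp only [ENNReal.toReal_mul, ENNReal.toReal_pow, ENNReal.toReal_ofReal hx.le,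
    ENNReal.toReal_ofReal hy.le] at h2
  rw [div_pow, div_lt_div_iff₀ ha' (pow_pos hy k)] at hk
  linarith [mul_comm a.toReal (x ^ k)]

/-! ### Measures dominated by `μ`, and translation -/

theorem rnDeriv_le_of_le_smul {μ σ : Measure ℝ} [IsFiniteMeasure μ] [IsFiniteMeasure σ] {K : ℝ≥0∞}
    (h : σ ≤ K • μ) : ∀ᵐ x ∂μ, σ.rnDeriv μ x ≤ K := by
  refine ae_le_of_forall_setLIntegral_le_of_sigmaFinite (Measure.measurable_rnDeriv σ μ)
    fun s _ _ => ?_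
  calc ∫⁻ x in s, σ.rnDeriv μ x ∂μ ≤ σ s := Measure.setLIntegral_rnDeriv_le s
    _ ≤ (K • μ) s := h s
    _ = ∫⁻ _ in s, K ∂μ := by simp

theorem absolutelyContinuous_of_le_smul {μ σ : Measure ℝ} {K : ℝ≥0∞} (h : σ ≤ K • μ) : σ ≪ μ :=
  (Measure.absolutelyContinuous_of_le h).trans Measure.smul_absolutelyContinuous

/-- The Radon–Nikodym derivative `dσ/dμ` as a complex-valued function. -/
noncomputable def complexDensity (σ μ : Measure ℝ) (x : ℝ) : ℂ :=
  ((σ.rnDeriv μ x).toReal : ℂ)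

theorem measurable_complexDensity {μ σ : Measure ℝ} : Measurable (complexDensity σ μ) :=
  Complex.measurable_ofReal.comp (Measure.measurable_rnDeriv σ μ).ennreal_toReal

theorem eLpNorm_complexDensity_sq {μ σ : Measure ℝ} [IsFiniteMeasure σ] :
    eLpNorm (complexDensity σ μ) 2 μ ^ 2 = ∫⁻ x, σ.rnDeriv μ x ^ 2 ∂μ := by
  rw [eLpNorm_eq_lintegral_rpow_enorm_toReal (by simp) (by simp)]
  simp only [ENNReal.toReal_ofNat, one_div, ENNReal.rpow_ofNat]
  rw [← ENNReal.rpow_natCast, ← ENNReal.rpow_mul]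
  norm_num
  refine lintegral_congr_ae ?_
  filter_upwards [Measure.rnDeriv_lt_top σ μ] with x hx
  rw [complexDensity, ← ofReal_norm, Complex.norm_real, Real.norm_of_nonneg (by simp),
    ENNReal.ofReal_toReal hx.ne]

theorem memLp_complexDensity {μ σ : Measure ℝ} [IsFiniteMeasure μ] [IsFiniteMeasure σ]
    {K : ℝ≥0∞} (hK : K ≠ ∞) (h : σ ≤ K • μ) :
    MemLp (complexDensity σ μ) 2 μ := by
  refine MemLp.of_bound measurable_complexDensity.aestronglyMeasurable K.toReal ?_
  filter_upwards [rnDeriv_le_of_le_smul h] with x hx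
  rw [complexDensity, Complex.norm_real, Real.norm_of_nonneg (by simp)]
  exact ENNReal.toReal_mono hK hx

theorem fourierMeasure_complexDensity {μ σ : Measure ℝ} [IsFiniteMeasure μ] [IsFiniteMeasure σ]
    (h : σ ≪ μ) (t : ℝ) :
    fourierMeasure μ (complexDensity σ μ) t =
      ∫ x, Complex.exp (-(2 * Real.pi * t * x : ℝ) * Complex.I) ∂σ := by
  rw [← integral_rnDeriv_smul h]
  simp [fourierMeasure, complexDensity]

/-- The frame inequalities with given bounds. -/
def FrameBounds (μ ν : Measure ℝ) (A B : ℝ≥0∞) : Prop :=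
  ∀ f : ℝ → ℂ, MemLp f 2 μ →
    A * eLpNorm f 2 μ ^ 2 ≤ eLpNorm (fourierMeasure μ f) 2 ν ^ 2 ∧
    eLpNorm (fourierMeasure μ f) 2 ν ^ 2 ≤ B * eLpNorm f 2 μ ^ 2

theorem lintegral_rnDeriv_sq_le {μ σ : Measure ℝ} [IsFiniteMeasure μ] [IsFiniteMeasure σ]
    {K : ℝ≥0∞} (h : σ ≤ K • μ) : ∫⁻ x, σ.rnDeriv μ x ^ 2 ∂μ ≤ K * σ Set.univ := by
  calc ∫⁻ x, σ.rnDeriv μ x ^ 2 ∂μ ≤ ∫⁻ x, K * σ.rnDeriv μ x ∂μ := by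
        refine lintegral_mono_ae ?_
        filter_upwards [rnDeriv_le_of_le_smul h] with x hx
        rw [sq]
        gcongr
    _ = K * ∫⁻ x, σ.rnDeriv μ x ∂μ := lintegral_const_mul _ (Measure.measurable_rnDeriv σ μ)
    _ ≤ K * σ Set.univ := by gcongr; exact Measure.lintegral_rnDeriv_le

theorem sq_measure_le_lintegral_rnDeriv_sq {μ σ : Measure ℝ} [IsFiniteMeasure μ]
    [IsFiniteMeasure σ] (h : σ ≪ μ) (U : Set ℝ) :
    σ U ^ 2 ≤ (∫⁻ x, σ.rnDeriv μ x ^ 2 ∂μ) * μ U := by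
  have hm := Measure.measurable_rnDeriv σ μ
  have hcs := ENNReal.lintegral_mul_le_Lp_mul_Lq (μ.restrict U) Real.HolderConjugate.two_two
    hm.aemeasurable (aemeasurable_const (b := (1 : ℝ≥0∞)))
  simp only [Pi.mul_apply, mul_one, Measure.setLIntegral_rnDeriv h, ENNReal.rpow_ofNat, one_pow,
    lintegral_const, one_mul, Measure.restrict_apply_univ] at hcs
  calc σ U ^ 2 ≤ ((∫⁻ x in U, σ.rnDeriv μ x ^ 2 ∂μ) ^ (1 / 2 : ℝ) * μ U ^ (1 / 2 : ℝ)) ^ 2 := by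
        gcongr
    _ = (∫⁻ x in U, σ.rnDeriv μ x ^ 2 ∂μ) * μ U := by
        rw [mul_pow, ← ENNReal.rpow_natCast, ← ENNReal.rpow_mul, ← ENNReal.rpow_natCast,
          ← ENNReal.rpow_mul]
        norm_num
    _ ≤ _ := by gcongr; exact Measure.restrict_le_self

/-- Uniformity under translation of measures admitting a frame measure. -/
theorem FrameBounds.translate_le {μ ν : Measure ℝ} [IsFiniteMeasure μ] {A B : ℝ≥0∞}
    (hfr : FrameBounds μ ν A B) {σ : Measure ℝ} [IsFiniteMeasure σ] {K K' : ℝ≥0∞}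
    (hK : K ≠ ∞) (hK' : K' ≠ ∞) (a : ℝ) (h : σ ≤ K • μ) (h' : σ.map (· + a) ≤ K' • μ)
    (U : Set ℝ) :
    A * σ.map (· + a) U ^ 2 ≤ B * (K * σ Set.univ) * μ U := by
  set σ' := σ.map (· + a) with hσ'
  have hac := absolutelyContinuous_of_le_smul h
  have hac' := absolutelyContinuous_of_le_smul h'
  have hF : eLpNorm (fourierMeasure μ (complexDensity σ' μ)) 2 ν =
      eLpNorm (fourierMeasure μ (complexDensity σ μ)) 2 ν := by
    refine eLpNorm_congr_norm_ae (Filter.Eventually.of_forall fun t => ?_)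
    rw [fourierMeasure_complexDensity hac, fourierMeasure_complexDensity hac', hσ',
      integral_map (by fun_prop) (by fun_prop)]
    have : ∀ x : ℝ, Complex.exp (-(2 * Real.pi * t * (x + a) : ℝ) * Complex.I) =
        Complex.exp ((-(2 * Real.pi * t * a) : ℝ) * Complex.I) *
          Complex.exp (-(2 * Real.pi * t * x : ℝ) * Complex.I) := fun x => by
      rw [← Complex.exp_add]
      congr 1
      push_cast
      ring
    simp_rw [this]
    rw [integral_const_mul, norm_mul, Complex.norm_exp_ofReal_mul_I, one_mul]
  -- `K'` only makes the density of the translate square integrable; it does not enter the final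
  -- bound.
  have h1 := (hfr _ (memLp_complexDensity hK' h')).1
  have h2 := (hfr _ (memLp_complexDensity hK h)).2
  rw [eLpNorm_complexDensity_sq] at h1 h2
  calc A * σ' U ^ 2 ≤ A * ((∫⁻ x, σ'.rnDeriv μ x ^ 2 ∂μ) * μ U) := by
        gcongr; exact sq_measure_le_lintegral_rnDeriv_sq hac' U
    _ = A * (∫⁻ x, σ'.rnDeriv μ x ^ 2 ∂μ) * μ U := by ring
    _ ≤ B * (∫⁻ x, σ.rnDeriv μ x ^ 2 ∂μ) * μ U := by
        gcongr ?_ * _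
        exact h1.trans (hF ▸ h2)
    _ ≤ _ := by gcongr; exact lintegral_rnDeriv_sq_le h

/-! ### Geometry of the iterated function system -/

/-- The homothety of the line with centre `c` and ratio `r`. -/
def scaleAbout (c r x : ℝ) : ℝ := c + r * (x - c)

theorem measurable_scaleAbout (c r : ℝ) : Measurable (scaleAbout c r) := by
  unfold scaleAbout; fun_prop

theorem scaleAbout_comp (c r s : ℝ) : scaleAbout c r ∘ scaleAbout c s = scaleAbout c (r * s) := by
  ext x; simp [scaleAbout]; ring

theorem scaleAbout_preimage_closedBall (c l : ℝ) {r : ℝ} (hr : 0 < r) :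
    scaleAbout c r ⁻¹' Metric.closedBall c (r * l) = Metric.closedBall c l := by
  ext x
  simp [scaleAbout, Real.dist_eq, abs_of_pos hr, hr]

/-- The fixed point of `ifsMap lam b j`. -/
noncomputable def ifsFixedPoint {N : ℕ} (lam : ℝ) (b : Fin N → ℝ) (j : Fin N) : ℝ :=
  b j / (1 - lam)

theorem ifsMap_eq_scaleAbout {N : ℕ} {lam : ℝ} (hlam1 : lam < 1) (b : Fin N → ℝ) (j : Fin N) :
    ifsMap lam b j = scaleAbout (ifsFixedPoint lam b j) lam := by
  ext x
  have : 1 - lam ≠ 0 := by linarith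
  simp only [ifsMap, scaleAbout, ifsFixedPoint]
  field_simp
  ring

theorem ifsMap_fixedPoint {N : ℕ} {lam : ℝ} (hlam1 : lam < 1) (b : Fin N → ℝ) (j : Fin N) :
    ifsMap lam b j (ifsFixedPoint lam b j) = ifsFixedPoint lam b j := by
  simp [ifsMap_eq_scaleAbout hlam1, scaleAbout]

theorem IsAttractor.subset_Icc {n : ℕ} {lam : ℝ} {b : Fin (n + 1) → ℝ} {X : Set ℝ}
    (hX : IsAttractor lam b X) (hlam0 : 0 < lam) (hlam1 : lam < 1) (hb : StrictMono b) :
    X ⊆ Set.Icc (ifsFixedPoint lam b 0) (ifsFixedPoint lam b (Fin.last n)) := by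
  have h1 : 0 < 1 - lam := by linarith
  have hpre : ∀ x ∈ X, ∃ y ∈ X, ∃ i, lam * y + b i = x := fun x hx => by
    rw [hX.invariant] at hx
    obtain ⟨i, y, hy, rfl⟩ := Set.mem_iUnion.1 hx
    exact ⟨y, hy, i, rfl⟩
  obtain ⟨m, hm, hmin⟩ := hX.isCompact.exists_isLeast hX.nonempty
  obtain ⟨M, hM, hmax⟩ := hX.isCompact.exists_isGreatest hX.nonempty
  intro x hx
  constructor
  · refine le_trans ?_ (hmin hx)
    obtain ⟨y, hy, i, rfl⟩ := hpre m hm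
    have := hb.monotone (Fin.zero_le i)
    rw [ifsFixedPoint, div_le_iff₀ h1]
    nlinarith [mul_le_mul_of_nonneg_left (hmin hy) hlam0.le]
  · refine le_trans (hmax hx) ?_
    obtain ⟨y, hy, i, rfl⟩ := hpre M hM
    have := hb.monotone (Fin.le_last i)
    rw [ifsFixedPoint, le_div_iff₀ h1]
    nlinarith [mul_le_mul_of_nonneg_left (hmax hy) hlam0.le]

/-! ### Scaling of `μ` at fixed points and comparison of weights -/

section SelfSimilar

variable {N : ℕ} {lam : ℝ} {b p : Fin N → ℝ} {μ : Measure ℝ}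

/-- Iterate the invariance of `μ`, keeping only the `j`-th term each time. -/
theorem IsSelfSimilarMeasure.ofReal_pow_mul_le (hμ : IsSelfSimilarMeasure lam b p μ)
    (hlam1 : lam < 1) (j : Fin N) (k : ℕ) {E : Set ℝ} (hE : MeasurableSet E) :
    ENNReal.ofReal (p j) ^ k * μ (scaleAbout (ifsFixedPoint lam b j) (lam ^ k) ⁻¹' E) ≤ μ E := by
  induction k generalizing E with
  | zero =>
    have : scaleAbout (ifsFixedPoint lam b j) 1 = id := by ext x; simp [scaleAbout]
    simp [this]
  | succ k ih =>
    set c := ifsFixedPoint lam b j with hc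
    have hE' := measurable_scaleAbout c lam hE
    calc _ = ENNReal.ofReal (p j) * (ENNReal.ofReal (p j) ^ k *
          μ (scaleAbout c (lam ^ k) ⁻¹' (scaleAbout c lam ⁻¹' E))) := by
          rw [← Set.preimage_comp, scaleAbout_comp, ← pow_succ', pow_succ', mul_assoc]
      _ ≤ ENNReal.ofReal (p j) * μ (scaleAbout c lam ⁻¹' E) := by gcongr; exact ih hE'
      _ ≤ μ E := by
          rw [hμ.invariant E hE, hc, ← ifsMap_eq_scaleAbout hlam1]
          exact Finset.single_le_sum (f := fun i => ENNReal.ofReal (p i) * μ (ifsMap lam b i ⁻¹' E))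
            (fun _ _ => zero_le) (Finset.mem_univ j)

theorem IsSelfSimilarMeasure.map_scaleAbout_le (hμ : IsSelfSimilarMeasure lam b p μ)
    (hlam1 : lam < 1) {j : Fin N} (hj : 0 < p j) (k : ℕ) :
    μ.map (scaleAbout (ifsFixedPoint lam b j) (lam ^ k)) ≤ (ENNReal.ofReal (p j) ^ k)⁻¹ • μ := by
  refine Measure.le_iff.2 fun E hE => ?_
  rw [Measure.map_apply (measurable_scaleAbout _ _) hE, Measure.smul_apply, smul_eq_mul, mul_comm,
    ← div_eq_mul_inv, ENNReal.le_div_iff_mul_le (by simp [hj]) (by simp), mul_comm]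
  exact hμ.ofReal_pow_mul_le hlam1 j k hE

/-- If the other maps stay away from the fixed point of the `j`-th one, then small balls around it
have measure at most a multiple of `p j ^ k`. -/
theorem IsSelfSimilarMeasure.exists_closedBall_le (hμ : IsSelfSimilarMeasure lam b p μ)
    (hlam0 : 0 < lam) (hlam1 : lam < 1) {j : Fin N} (hj : 0 < p j) (l : ℝ) {δ : ℝ} (hδ : 0 < δ)
    (hsep : ∀ i ≠ j, ∀ᵐ x ∂μ, δ ≤ dist (ifsMap lam b i x) (ifsFixedPoint lam b j)) :
    ∃ C : ℝ≥0∞, C ≠ ∞ ∧ ∀ k : ℕ,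
      μ (Metric.closedBall (ifsFixedPoint lam b j) (lam ^ k * l)) ≤ C * ENNReal.ofReal (p j) ^ k := by
  have := hμ.isProbabilityMeasure
  set c := ifsFixedPoint lam b j with hc
  set q := ENNReal.ofReal (p j) with hq
  have hq0 : q ≠ 0 := by simp [hq, hj]
  have hqt : q ≠ ∞ := by simp [hq]
  have hlim : Filter.Tendsto (fun k : ℕ => lam ^ k * l) Filter.atTop (nhds 0) := by
    simpa using (tendsto_pow_atTop_nhds_zero_of_lt_one hlam0.le hlam1).mul_const l
  -- From scale `n₀` on, the ball is too small to meet the other pieces, so each further step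
  -- multiplies its measure by exactly `q`.
  obtain ⟨n₀, hn₀⟩ := Filter.eventually_atTop.1 (hlim.eventually (gt_mem_nhds hδ))
  have hstep : ∀ k ≥ n₀, μ (Metric.closedBall c (lam ^ (k + 1) * l)) =
      q * μ (Metric.closedBall c (lam ^ k * l)) := by
    intro k hk
    rw [hμ.invariant _ Metric.isClosed_closedBall.measurableSet, Finset.sum_eq_single j]
    · rw [ifsMap_eq_scaleAbout hlam1, pow_succ', mul_assoc, ← hc,
        scaleAbout_preimage_closedBall _ _ hlam0]
    · intro i _ hi
      have : μ (ifsMap lam b i ⁻¹' Metric.closedBall c (lam ^ (k + 1) * l)) = 0 := by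
        refine measure_mono_null ?_ (ae_iff.1 (hsep i hi))
        intro x hx
        have hx' : dist (ifsMap lam b i x) c ≤ lam ^ (k + 1) * l := hx
        exact not_le.2 (hx'.trans_lt (hn₀ (k + 1) (by omega)))
      rw [this, mul_zero]
    · simp
  refine ⟨(q ^ n₀)⁻¹, by simp [hq0], fun k => ?_⟩
  have hle : ∀ m, μ (Metric.closedBall c (lam ^ (n₀ + m) * l)) ≤ q ^ m := by
    intro m
    induction m with
    | zero => simpa using prob_le_one
    | succ m ih => rw [← add_assoc, hstep _ (by omega), pow_succ']; gcongr
  rw [mul_comm (q ^ n₀)⁻¹, ← div_eq_mul_inv,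
    ENNReal.le_div_iff_mul_le (by simp [hq0]) (by simp [hqt])]
  rcases le_total n₀ k with h | h
  · obtain ⟨m, rfl⟩ := Nat.exists_eq_add_of_le h
    rw [pow_add q, mul_comm (q ^ n₀)]
    gcongr
    exact hle m
  · have hp1 : q ≤ 1 := by
      simpa [hq] using hμ.ofReal_pow_mul_le hlam1 j 1 MeasurableSet.univ
    calc _ ≤ 1 * q ^ n₀ := by gcongr; exact prob_le_one
      _ ≤ q ^ k := by rw [one_mul]; exact pow_le_pow_right_of_le_one' hp1 h

theorem IsSelfSimilarMeasure.map_scaleAbout_closedBall (hμ : IsSelfSimilarMeasure lam b p μ)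
    {c l r : ℝ} (hr : 0 < r) (hl : ∀ᵐ x ∂μ, x ∈ Metric.closedBall c l) :
    μ.map (scaleAbout c r) (Metric.closedBall c (r * l)) = 1 := by
  have := hμ.isProbabilityMeasure
  rw [Measure.map_apply (measurable_scaleAbout _ _) Metric.isClosed_closedBall.measurableSet,
    scaleAbout_preimage_closedBall _ _ hr]
  exact (mem_ae_iff_prob_eq_one Metric.isClosed_closedBall.measurableSet).1 hl

theorem IsSelfSimilarMeasure.weight_le (hμ : IsSelfSimilarMeasure lam b p μ)
    (hlam0 : 0 < lam) (hlam1 : lam < 1) (hp : ∀ i, 0 < p i) {ν : Measure ℝ} {A B : ℝ≥0∞}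
    (hA : A ≠ 0) (hB : B ≠ ∞) (hfr : FrameBounds μ ν A B) {i : Fin N} {l : ℝ}
    (hl : ∀ᵐ x ∂μ, x ∈ Metric.closedBall (ifsFixedPoint lam b i) l) {δ : ℝ} (hδ : 0 < δ)
    (hsep : ∀ j ≠ i, ∀ᵐ x ∂μ, δ ≤ dist (ifsMap lam b j x) (ifsFixedPoint lam b i)) (j : Fin N) :
    p j ≤ p i := by
  have := hμ.isProbabilityMeasure
  obtain ⟨C, hC, hCk⟩ := hμ.exists_closedBall_le hlam0 hlam1 (hp i) l hδ hsep
  refine le_of_forall_mul_pow_le (hp j) (hp i) hA (ENNReal.mul_ne_top hB hC) fun k => ?_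
  set ci := ifsFixedPoint lam b i
  set cj := ifsFixedPoint lam b j
  set q := ENNReal.ofReal (p j) with hq
  have hq0 : q ^ k ≠ 0 := by simp [hq, hp j]
  have hqt : q ^ k ≠ ∞ := by simp [hq]
  have hqi : ENNReal.ofReal (p i) ^ k ≠ 0 := by simp [hp i]
  -- Homotheties of equal ratio differ by a translation.
  have htrans : (μ.map (scaleAbout cj (lam ^ k))).map (· + (ci - cj) * (1 - lam ^ k)) =
      μ.map (scaleAbout ci (lam ^ k)) := by
    rw [Measure.map_map (by fun_prop) (measurable_scaleAbout _ _)]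
    congr 1
    ext x
    simp [scaleAbout]
    ring
  have : IsProbabilityMeasure (μ.map (scaleAbout cj (lam ^ k))) :=
    Measure.isProbabilityMeasure_map (measurable_scaleAbout _ _).aemeasurable
  have h := hfr.translate_le (ENNReal.inv_ne_top.2 hq0) (ENNReal.inv_ne_top.2 hqi) _
    (hμ.map_scaleAbout_le hlam1 (hp j) k) (htrans ▸ hμ.map_scaleAbout_le hlam1 (hp i) k)
    (Metric.closedBall ci (lam ^ k * l))
  rw [htrans, hμ.map_scaleAbout_closedBall (pow_pos hlam0 k) hl, measure_univ, one_pow, mul_one,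
    mul_one] at h
  calc A * q ^ k ≤ B * (q ^ k)⁻¹ * (C * ENNReal.ofReal (p i) ^ k) * q ^ k := by
        gcongr; exact h.trans (by gcongr; exact hCk k)
    _ = B * C * ENNReal.ofReal (p i) ^ k * ((q ^ k)⁻¹ * q ^ k) := by ring
    _ = B * C * ENNReal.ofReal (p i) ^ k := by rw [ENNReal.inv_mul_cancel hq0 hqt, mul_one]

end SelfSimilar

/-! ### Bounds on a Lebesgue density -/

/-- By Fubini, the integral over `a` of these volumes is `volume P * volume Q`. -/
theorem exists_volume_inter_translate_ne_zero {P Q : Set ℝ} (hP : MeasurableSet P)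
    (hQ : MeasurableSet Q) (hP0 : volume P ≠ 0) (hQ0 : volume Q ≠ 0) :
    ∃ a : ℝ, volume (P ∩ (· + a) ⁻¹' Q) ≠ 0 := by
  by_contra! h
  have hmp := measurePreserving_prod_add (volume : Measure ℝ) (volume : Measure ℝ)
  have hE : MeasurableSet ((fun z : ℝ × ℝ => (z.1, z.1 + z.2)) ⁻¹' P ×ˢ Q) :=
    hmp.measurable (hP.prod hQ)
  have h0 : ((volume : Measure ℝ).prod volume) (P ×ˢ Q) = 0 := by
    rw [← hmp.measure_preimage (hP.prod hQ).nullMeasurableSet, Measure.prod_apply_symm hE]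
    exact (lintegral_congr fun a => h a).trans lintegral_zero
  rw [Measure.prod_prod] at h0
  exact (mul_ne_zero hP0 hQ0) h0

theorem restrict_le_inv_smul_withDensity {h : ℝ → ℝ≥0∞} {M : ℝ≥0∞}
    (hM : M ≠ 0) (hM' : M ≠ ∞) {G : Set ℝ} (hG : MeasurableSet G) (hGM : ∀ x ∈ G, M ≤ h x) :
    (volume : Measure ℝ).restrict G ≤ M⁻¹ • volume.withDensity h := by
  refine Measure.le_iff.2 fun E hE => ?_
  rw [Measure.smul_apply, smul_eq_mul, mul_comm, ← div_eq_mul_inv,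
    ENNReal.le_div_iff_mul_le (by simp [hM]) (by simp [hM']), Measure.restrict_apply hE, mul_comm,
    ← setLIntegral_const]
  calc ∫⁻ _ in E ∩ G, M ≤ ∫⁻ x in E ∩ G, h x :=
        setLIntegral_mono' (hE.inter hG) fun x hx => hGM x hx.2
    _ = volume.withDensity h (E ∩ G) := (withDensity_apply _ (hE.inter hG)).symm
    _ ≤ _ := measure_mono Set.inter_subset_left

/-- Translate Lebesgue measure from a piece `G` where `h` is at least `M` onto a piece where `h` is
at most `m`. The cutoff `ε` only ensures domination by `μ` and is absent from the conclusion. -/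
theorem FrameBounds.density_le {h : ℝ → ℝ≥0∞} (hh : Measurable h)
    [IsFiniteMeasure ((volume : Measure ℝ).withDensity h)] {ν : Measure ℝ} {A B : ℝ≥0∞}
    (hfr : FrameBounds (volume.withDensity h) ν A B) {M ε m : ℝ≥0∞} (hM : M ≠ 0) (hM' : M ≠ ∞)
    (hε : ε ≠ 0) (hε' : ε ≠ ∞) (hP : volume {x | M ≤ h x} ≠ 0) (hQ : volume {x | ε ≤ h x ∧ h x ≤ m} ≠ 0) :
    A * M ≤ B * m := by
  have hPm : MeasurableSet {x | M ≤ h x} := measurableSet_le measurable_const hh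
  have hQm : MeasurableSet {x | ε ≤ h x ∧ h x ≤ m} :=
    (measurableSet_le measurable_const hh).inter (measurableSet_le hh measurable_const)
  obtain ⟨a, ha⟩ := exists_volume_inter_translate_ne_zero hPm hQm hP hQ
  set G := {x | M ≤ h x} ∩ (· + a) ⁻¹' {x | ε ≤ h x ∧ h x ≤ m} with hG
  have hGm : MeasurableSet G := hPm.inter (measurable_add_const a hQm)
  set G' := (· + -a) ⁻¹' G with hG'
  have hGm' : MeasurableSet G' := measurable_add_const (-a) hGm
  have hG'Q : ∀ x ∈ G', ε ≤ h x ∧ h x ≤ m := fun x hx => by simpa using hx.2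
  have hmap : ((volume : Measure ℝ).restrict G).map (· + a) = volume.restrict G' := by
    have := (measurePreserving_add_right (volume : Measure ℝ) a).restrict_preimage hGm'
    rw [hG', ← Set.preimage_comp] at this
    simpa [Function.comp_def] using this.map_eq
  have hvol : volume G' = volume G := measure_preimage_add_right _ _ _
  have hle := restrict_le_inv_smul_withDensity hM hM' hGm fun x hx => hx.1
  have hle' := restrict_le_inv_smul_withDensity hε hε' hGm' fun x hx => (hG'Q x hx).1
  have hGt : volume G ≠ ∞ := by
    have := hle Set.univ
    rw [Measure.restrict_apply_univ] at this
    exact ne_top_of_le_ne_top (ENNReal.mul_ne_top (ENNReal.inv_ne_top.2 hM) (measure_ne_top _ _)) this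
  have : IsFiniteMeasure ((volume : Measure ℝ).restrict G) :=
    isFiniteMeasure_restrict.2 hGt
  have key := hfr.translate_le (ENNReal.inv_ne_top.2 hM) (ENNReal.inv_ne_top.2 hε) a hle
    (hmap ▸ hle') G'
  have hμ : volume.withDensity h G' ≤ m * volume G := by
    rw [withDensity_apply _ hGm', ← hvol, ← setLIntegral_const]
    exact setLIntegral_mono' hGm' fun x hx => (hG'Q x hx).2
  rw [hmap, Measure.restrict_apply_self, hvol, Measure.restrict_apply_univ] at key
  have key2 : A * volume G ^ 2 ≤ B * (M⁻¹ * volume G) * (m * volume G) :=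
    key.trans (by gcongr)
  have hG2 : volume G ^ 2 ≠ 0 := pow_ne_zero 2 ha
  have hG2t : volume G ^ 2 ≠ ∞ := ENNReal.pow_ne_top hGt
  have key3 : volume G ^ 2 * (A * M) ≤ volume G ^ 2 * (B * m) := by
    calc volume G ^ 2 * (A * M) = A * volume G ^ 2 * M := by ring
      _ ≤ B * (M⁻¹ * volume G) * (m * volume G) * M := by gcongr
      _ = volume G ^ 2 * (B * m) * (M⁻¹ * M) := by ring
      _ = _ := by rw [ENNReal.inv_mul_cancel hM hM', mul_one]
  exact (ENNReal.mul_le_mul_iff_right hG2 hG2t).1 key3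

/-- The density of an absolutely continuous measure with a frame measure is bounded, and bounded
below on its support. -/
theorem FrameBounds.exists_density_bounds {h : ℝ → ℝ≥0∞} (hh : Measurable h)
    [IsFiniteMeasure ((volume : Measure ℝ).withDensity h)] (h0 : volume.withDensity h ≠ 0)
    {ν : Measure ℝ} {A B : ℝ≥0∞} (hA : A ≠ 0) (hA' : A ≠ ∞) (hB : B ≠ 0) (hB' : B ≠ ∞)
    (hfr : FrameBounds (volume.withDensity h) ν A B) :
    ∃ c K : ℝ≥0∞, c ≠ 0 ∧ K ≠ ∞ ∧ ∀ᵐ x : ℝ, h x ≤ K ∧ (h x = 0 ∨ c ≤ h x) := by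
  have htop : ∀ᵐ x : ℝ, h x < ∞ := ae_lt_top hh (by
    rw [← setLIntegral_univ, ← withDensity_apply _ MeasurableSet.univ]; exact measure_ne_top _ _)
  have hinv0 : ∀ n : ℕ, ((n : ℝ≥0∞) + 1)⁻¹ ≠ 0 := fun n => by simp
  obtain ⟨n, hn⟩ : ∃ n : ℕ, volume {x | ((n : ℝ≥0∞) + 1)⁻¹ ≤ h x ∧ h x ≤ (n : ℝ≥0∞) + 1} ≠ 0 := by
    by_contra! hall
    refine h0 (withDensity_eq_zero_iff hh.aemeasurable |>.2 ?_)
    have : ∀ᵐ x : ℝ, ∀ n : ℕ, ¬ (((n : ℝ≥0∞) + 1)⁻¹ ≤ h x ∧ h x ≤ (n : ℝ≥0∞) + 1) :=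
      ae_all_iff.2 fun n => by simpa only [ae_iff, not_not] using hall n
    filter_upwards [this, htop] with x hx hxt
    by_contra hx0
    obtain ⟨n₁, hn₁⟩ := ENNReal.exists_inv_nat_lt hx0
    obtain ⟨n₂, hn₂⟩ := ENNReal.exists_nat_gt hxt.ne
    refine hx (max n₁ n₂) ⟨le_trans (ENNReal.inv_le_inv.2 ?_) hn₁.le, hn₂.le.trans ?_⟩
    · exact le_trans (by exact_mod_cast le_max_left n₁ n₂) le_self_add
    · exact le_trans (by exact_mod_cast le_max_right n₁ n₂) le_self_add
  set ε := ((n : ℝ≥0∞) + 1)⁻¹ with hε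
  have hε0 : ε ≠ 0 := hinv0 n
  have hεt : ε ≠ ∞ := by simp [hε]
  set m := (n : ℝ≥0∞) + 1 with hm
  have hmt : m ≠ ∞ := by simp [hm]
  have hPn : volume {x | ε ≤ h x} ≠ 0 := fun h' => hn (measure_mono_null (fun x hx => hx.1) h')
  set c := A * ε / B / 2 with hc
  have hc0 : c ≠ 0 := by simp [hc, hA, hε0, hB', ENNReal.div_eq_zero_iff]
  have hABε : A * ε / B ≠ ∞ := ENNReal.div_ne_top (ENNReal.mul_ne_top hA' hεt) hB
  have hABε0 : A * ε / B ≠ 0 := by simp [hA, hε0, hB', ENNReal.div_eq_zero_iff]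
  have hBc : B * c < A * ε := by
    have : c < A * ε / B := ENNReal.half_lt_self hABε0 hABε
    rw [mul_comm]
    exact ENNReal.mul_lt_of_lt_div this
  set K := B * m / A + 1 with hK
  have hBmA : B * m / A ≠ ∞ := ENNReal.div_ne_top (ENNReal.mul_ne_top hB' hmt) hA
  have hKt : K ≠ ∞ := ENNReal.add_ne_top.2 ⟨hBmA, by simp⟩
  have hAK : B * m < A * K := by
    rw [mul_comm A, ← ENNReal.div_lt_iff (Or.inl hA) (Or.inl hA')]
    exact ENNReal.lt_add_right hBmA one_ne_zero
  have hupper : volume {x | K ≤ h x} = 0 := by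
    by_contra hne
    exact absurd (hfr.density_le hh (by simp [hK]) hKt hε0 hεt hne hn) (not_le.2 hAK)
  -- As the bound is independent of the cutoff, one `c` works for every `k`, which excludes all
  -- values `0 < h x ≤ c`.
  have hlower : ∀ᵐ x : ℝ, ∀ k : ℕ, ¬ (((k : ℝ≥0∞) + 1)⁻¹ ≤ h x ∧ h x ≤ c) := by
    refine ae_all_iff.2 fun k => ?_
    simp only [ae_iff, not_not]
    by_contra hne
    exact absurd (hfr.density_le hh hε0 hεt (hinv0 k) (by simp) hPn hne) (not_le.2 hBc)
  refine ⟨c, K, hc0, hKt, ?_⟩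
  have hupper' : ∀ᵐ x : ℝ, ¬ K ≤ h x := by simpa only [ae_iff, not_not] using hupper
  filter_upwards [hupper', hlower] with x hx hx'
  refine ⟨(not_le.1 hx).le, ?_⟩
  by_contra! hcon
  obtain ⟨k, hk⟩ := ENNReal.exists_inv_nat_lt hcon.1
  exact hx' k ⟨le_trans (ENNReal.inv_le_inv.2 le_self_add) hk.le, hcon.2.le⟩

/-! ### Extreme weights equal the contraction ratio -/

theorem volume_scaleAbout_preimage (c : ℝ) {r : ℝ} (hr : 0 < r) (E : Set ℝ) :
    ENNReal.ofReal r * volume (scaleAbout c r ⁻¹' E) = volume E := by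
  have : scaleAbout c r = (fun x => x + (c - r * c)) ∘ (fun x => r * x) := by
    ext x; simp [scaleAbout]; ring
  rw [this, Set.preimage_comp, Real.volume_preimage_mul_left hr.ne', measure_preimage_add_right,
    abs_of_pos (inv_pos.2 hr), ← mul_assoc, ← ENNReal.ofReal_mul hr.le, mul_inv_cancel₀ hr.ne',
    ENNReal.ofReal_one, one_mul]

/-- If the density of a self-similar measure is bounded and bounded below on its support, then the
weight of an extreme map is the contraction ratio. -/
theorem IsSelfSimilarMeasure.weight_eq {N : ℕ} {lam : ℝ} {b p : Fin N → ℝ} {μ : Measure ℝ}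
    (hμ : IsSelfSimilarMeasure lam b p μ) (hlam0 : 0 < lam) (hlam1 : lam < 1) {i : Fin N}
    (hi : 0 < p i) {l : ℝ} (hl : ∀ᵐ x ∂μ, x ∈ Metric.closedBall (ifsFixedPoint lam b i) l)
    {δ : ℝ} (hδ : 0 < δ)
    (hsep : ∀ j ≠ i, ∀ᵐ x ∂μ, δ ≤ dist (ifsMap lam b j x) (ifsFixedPoint lam b i))
    {h : ℝ → ℝ≥0∞} (hh : Measurable h) (hμh : μ = volume.withDensity h) {c K : ℝ≥0∞}
    (hc : c ≠ 0) (hK : K ≠ ∞) (hbd : ∀ᵐ x : ℝ, h x ≤ K ∧ (h x = 0 ∨ c ≤ h x)) : p i = lam := by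
  have := hμ.isProbabilityMeasure
  set x₀ := ifsFixedPoint lam b i with hx₀
  have hball : ∀ r, MeasurableSet (Metric.closedBall x₀ r) := fun r =>
    Metric.isClosed_closedBall.measurableSet
  have hq0 : ∀ k : ℕ, ENNReal.ofReal (p i) ^ k ≠ 0 := fun k => by simp [hi]
  apply le_antisymm
  · refine le_of_forall_mul_pow_le (a := 1) (C := K * ENNReal.ofReal (2 * l)) hi hlam0 one_ne_zero
      (by finiteness) fun k => ?_
    have h1 := hμ.ofReal_pow_mul_le hlam1 i k (hball (lam ^ k * l))
    rw [← hx₀, scaleAbout_preimage_closedBall _ _ (pow_pos hlam0 k),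
      (mem_ae_iff_prob_eq_one (hball l)).1 hl, mul_one] at h1
    calc 1 * ENNReal.ofReal (p i) ^ k ≤ μ (Metric.closedBall x₀ (lam ^ k * l)) := by rwa [one_mul]
      _ ≤ ∫⁻ _ in Metric.closedBall x₀ (lam ^ k * l), K := by
          rw [hμh, withDensity_apply _ (hball _)]
          exact lintegral_mono_ae (ae_restrict_of_ae (hbd.mono fun x hx => hx.1))
      _ = K * ENNReal.ofReal (2 * l) * ENNReal.ofReal lam ^ k := by
          rw [setLIntegral_const, Real.volume_closedBall, mul_left_comm,
            ENNReal.ofReal_mul (pow_nonneg hlam0.le k), ENNReal.ofReal_pow hlam0.le]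
          ring
  · obtain ⟨C, hC, hCk⟩ := hμ.exists_closedBall_le hlam0 hlam1 hi l hδ hsep
    set D := {x | h x ≠ 0} with hD
    have hDm : MeasurableSet D := (hh (measurableSet_singleton 0)).compl
    have hμD : μ Dᶜ = 0 := by
      rw [hμh, withDensity_apply_eq_zero hh]
      simp [hD]
    have hDS : ∀ S, MeasurableSet S → μ S = 0 → volume (D ∩ S) = 0 := by
      intro S hS h0
      rw [hμh, withDensity_apply_eq_zero hh] at h0
      exact h0
    set W := D ∩ Metric.closedBall x₀ l with hW
    have hW0 : volume W ≠ 0 := by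
      intro h0
      have hμW : μ W = 0 := by
        rw [hμh]; exact withDensity_absolutelyContinuous _ _ h0
      have : μ (Metric.closedBall x₀ l) = 0 := by
        refine measure_mono_null (t := W ∪ Dᶜ) (fun x hx => ?_) (measure_union_null hμW hμD)
        by_cases hxD : x ∈ D
        · exact Or.inl ⟨hxD, hx⟩
        · exact Or.inr hxD
      rw [(mem_ae_iff_prob_eq_one (hball l)).1 hl] at this
      exact one_ne_zero this
    refine le_of_forall_mul_pow_le hlam0 hi (mul_ne_zero hc hW0) hC fun k => ?_
    have hr : 0 < lam ^ k := pow_pos hlam0 k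
    set S := scaleAbout x₀ (lam ^ k) with hS
    have hSm : Measurable S := measurable_scaleAbout _ _
    -- Self-similarity sends almost every point of `D` into `D`, so `D` fills at least a fixed
    -- proportion of each small ball.
    have hnull : volume (D ∩ S ⁻¹' Dᶜ) = 0 := by
      refine hDS _ (hSm hDm.compl) ?_
      have h1 := hμ.ofReal_pow_mul_le hlam1 i k hDm.compl
      rw [hμD, nonpos_iff_eq_zero, mul_eq_zero] at h1
      exact h1.resolve_left (hq0 k)
    set V := D ∩ Metric.closedBall x₀ (lam ^ k * l) with hV
    have hWV : volume W ≤ volume (S ⁻¹' V) := by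
      calc volume W ≤ volume (S ⁻¹' V ∪ D ∩ S ⁻¹' Dᶜ) := by
            refine measure_mono fun x hx => ?_
            by_cases hxD : S x ∈ D
            · refine Or.inl ⟨hxD, ?_⟩
              have : x ∈ S ⁻¹' Metric.closedBall x₀ (lam ^ k * l) := by
                rw [hS, scaleAbout_preimage_closedBall _ _ hr]; exact hx.2
              exact this
            · exact Or.inr ⟨hx.1, hxD⟩
        _ ≤ _ := (measure_union_le _ _).trans (by rw [hnull, add_zero])
    calc c * volume W * ENNReal.ofReal lam ^ k
        ≤ c * volume (S ⁻¹' V) * ENNReal.ofReal lam ^ k := by gcongr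
      _ = c * volume V := by
          rw [← volume_scaleAbout_preimage x₀ hr V, ENNReal.ofReal_pow hlam0.le]; ring
      _ = ∫⁻ _ in V, c := (setLIntegral_const _ _).symm
      _ ≤ ∫⁻ x in V, h x := by
          refine setLIntegral_mono_ae hh.aemeasurable (hbd.mono fun x hx hxV => ?_)
          exact hx.2.resolve_left hxV.1
      _ = μ V := by rw [hμh, withDensity_apply _ (hDm.inter (hball _))]
      _ ≤ μ (Metric.closedBall x₀ (lam ^ k * l)) := measure_mono Set.inter_subset_right
      _ ≤ C * ENNReal.ofReal (p i) ^ k := hCk k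

/-- Separation near the fixed point of a map with strictly extreme translation. -/
theorem exists_separation {N : ℕ} {lam : ℝ} (hlam0 : 0 < lam) (hlam1 : lam < 1) {b : Fin N → ℝ}
    {i : Fin N} {s : ℝ} (hs : |s| = 1) (hb : ∀ j ≠ i, 0 < s * (b j - b i)) :
    ∃ δ > 0, ∀ j ≠ i, ∀ x, 0 ≤ s * (x - ifsFixedPoint lam b i) →
      δ ≤ dist (ifsMap lam b j x) (ifsFixedPoint lam b i) := by
  have hbd : ∃ δ > 0, ∀ j ≠ i, δ ≤ s * (b j - b i) := by
    rcases (Finset.univ.erase i).eq_empty_or_nonempty with he | hne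
    · refine ⟨1, one_pos, fun j hj => ?_⟩
      have : j ∈ Finset.univ.erase i := by simp [hj]
      simp [he] at this
    · obtain ⟨j₀, hj₀, hmin⟩ := (Finset.univ.erase i).exists_min_image (fun j => s * (b j - b i)) hne
      exact ⟨_, hb j₀ (Finset.ne_of_mem_erase hj₀), fun j hj => hmin j (by simp [hj])⟩
  obtain ⟨δ, hδ, hδj⟩ := hbd
  refine ⟨δ, hδ, fun j hj x hx => ?_⟩
  set c := ifsFixedPoint lam b i with hc
  have hfix : lam * c + b i = c := ifsMap_fixedPoint hlam1 b i
  have heq : s * (ifsMap lam b j x - c) = lam * (s * (x - c)) + s * (b j - b i) := by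
    rw [ifsMap]; linear_combination s * hfix
  calc δ ≤ s * (ifsMap lam b j x - c) := by
        rw [heq]; linarith [hδj j hj, mul_nonneg hlam0.le hx]
    _ ≤ |s * (ifsMap lam b j x - c)| := le_abs_self _
    _ = dist (ifsMap lam b j x) c := by rw [abs_mul, hs, one_mul, Real.dist_eq]

theorem theorem4p1 {n : ℕ} (lam : ℝ) (hlam0 : 0 < lam) (hlam1 : lam < 1)
    (b : Fin (n + 1) → ℝ) (hb : StrictMono b)
    (p : Fin (n + 1) → ℝ) (hp : ∀ i, 0 < p i) (hpsum : ∑ i, p i = 1)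
    (X : Set ℝ) (hX : IsAttractor lam b X)
    (μ : Measure ℝ) (hμ : IsSelfSimilarMeasure lam b p μ)
    (α : ℝ) (hpos : 0 < μH[α] X) (hfin : μH[α] X < ⊤)
    (hac : μ ≪ (μH[α]).restrict X)
    (hframe : ∃ ν : Measure ℝ, IsFrameMeasure μ ν) :
    p 0 = p (Fin.last n) ∧
      (α = 1 → (∀ j, p j ≤ lam) ∧ p 0 = lam ∧ p (Fin.last n) = lam) := by
  have := hμ.isProbabilityMeasure
  obtain ⟨ν, A, B, hA, hB, hfr⟩ := hframe
  have hfr' : FrameBounds μ ν (ENNReal.ofReal A) (ENNReal.ofReal B) := hfr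
  have hA0 : ENNReal.ofReal A ≠ 0 := by simp [hA]
  have hB0 : ENNReal.ofReal B ≠ 0 := by simp [hB]
  set x₀ := ifsFixedPoint lam b 0 with hx₀
  set x₁ := ifsFixedPoint lam b (Fin.last n) with hx₁
  -- For (i), absolute continuity serves to place `μ` on `X`, hence between the extreme fixed
  -- points.
  have hsupp : ∀ᵐ x ∂μ, x ∈ Set.Icc x₀ x₁ :=
    Filter.Eventually.mono (hac.ae_le (ae_restrict_mem hX.isCompact.measurableSet))
      fun x hx => hX.subset_Icc hlam0 hlam1 hb hx
  have hl₀ : ∀ᵐ x ∂μ, x ∈ Metric.closedBall x₀ (x₁ - x₀) := hsupp.mono fun x hx => by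
    rw [Metric.mem_closedBall, Real.dist_eq, abs_le]; constructor <;> linarith [hx.1, hx.2]
  have hl₁ : ∀ᵐ x ∂μ, x ∈ Metric.closedBall x₁ (x₁ - x₀) := hsupp.mono fun x hx => by
    rw [Metric.mem_closedBall, Real.dist_eq, abs_le]; constructor <;> linarith [hx.1, hx.2]
  obtain ⟨δ₀, hδ₀, hsep₀⟩ := exists_separation (b := b) (i := 0) (s := 1) hlam0 hlam1 (by simp)
    fun j hj => by linarith [hb (Fin.pos_iff_ne_zero.2 hj)]
  obtain ⟨δ₁, hδ₁, hsep₁⟩ := exists_separation (b := b) (i := Fin.last n) (s := -1) hlam0 hlam1 (by simp)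
    fun j hj => by linarith [hb (Fin.lt_last_iff_ne_last.2 hj)]
  have hsep₀' : ∀ j ≠ 0, ∀ᵐ x ∂μ, δ₀ ≤ dist (ifsMap lam b j x) x₀ := fun j hj =>
    hsupp.mono fun x hx => hsep₀ j hj x (by linarith [hx.1])
  have hsep₁' : ∀ j ≠ Fin.last n, ∀ᵐ x ∂μ, δ₁ ≤ dist (ifsMap lam b j x) x₁ := fun j hj =>
    hsupp.mono fun x hx => hsep₁ j hj x (by linarith [hx.2])
  have hle₀ := hμ.weight_le hlam0 hlam1 hp hA0 ENNReal.ofReal_ne_top hfr' hl₀ hδ₀ hsep₀'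
  have hle₁ := hμ.weight_le hlam0 hlam1 hp hA0 ENNReal.ofReal_ne_top hfr' hl₁ hδ₁ hsep₁'
  have heq : p 0 = p (Fin.last n) := le_antisymm (hle₁ 0) (hle₀ _)
  refine ⟨heq, ?_⟩
  rintro rfl
  have hvol : μ ≪ volume := by
    rw [hausdorffMeasure_real] at hac
    exact hac.trans Measure.absolutelyContinuous_restrict
  have hμh : volume.withDensity (μ.rnDeriv volume) = μ := Measure.withDensity_rnDeriv_eq _ _ hvol
  have hh := Measure.measurable_rnDeriv μ (volume : Measure ℝ)
  set h := μ.rnDeriv volume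
  have hfin' : IsFiniteMeasure ((volume : Measure ℝ).withDensity h) := by rw [hμh]; infer_instance
  obtain ⟨c, K, hc, hK, hbd⟩ := FrameBounds.exists_density_bounds hh
    (by rw [hμh]; exact IsProbabilityMeasure.ne_zero μ) hA0 ENNReal.ofReal_ne_top hB0
    ENNReal.ofReal_ne_top (hμh.symm ▸ hfr')
  have hp0 : p 0 = lam := hμ.weight_eq hlam0 hlam1 (hp 0) hl₀ hδ₀ hsep₀' hh hμh.symm hc hK hbd
  exact ⟨fun j => hp0 ▸ hle₀ j, hp0, heq ▸ hp0⟩
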